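/- Let $0<\beta<1/2$, $0\le\theta\le1$, and let $K:(0,1)\to\mathbb R$ be measurable with $0<K_m\le K(x)\le K_M<\infty$ for almost every $x\in(0,1)$. For $\sigma>0$ put $${}_0^lI_x^{\sigma}w(x)=\frac1{\Gamma(\sigma)}\int_0^x\frac{w(s)}{(x-s)^{1-\sigma}}\,ds,\qquad {}_x^rI_1^{\sigma}w(x)=\frac1{\Gamma(\sigma)}\int_x^1\frac{w(s)}{(s-x)^{1-\sigma}}\,ds,\qquad I^\beta_\theta w=\theta\,{}_0^lI_x^\beta w+(1-\theta)\,{}_x^rI_1^\beta w,$$ and write ${}_0^rI_1^\beta u$ for the value of ${}_x^rI_1^\beta u$ at $x=0$ and ${}_0^lI_1^\beta u$ for the value of ${}_0^lI_x^\beta u$ at $x=1$. Let $H^{\mu}_0(0,1)$ be the completion of $C_c^\infty(0,1)$ in the norm $(\|w\|_{L^2(\mathbb R)}^2+\||\omega|^\mu\mathcal F w\|_{L^2(\mathbb R)}^2)^{1/2}$ of $H^\mu(\mathbb R)$, let $H^{-1}(0,1)$ be the dual space of $H^1_0(0,1)$, and let $D$ be the weak derivative. Let $f\in H^{-1}(0,1)$,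 and let $w_l,w_r,w_f\in H^1(0,1)\subset C[0,1]$ be the weak solutions of $$(KDw_l,Dv)_{L^2(0,1)}=0\quad\forall v\in H^1_0(0,1),\qquad w_l(0)=1,\ w_l(1)=0,$$ $$(KDw_r,Dv)_{L^2(0,1)}=0\quad\forall v\in H^1_0(0,1),\qquad w_r(0)=0,\ w_r(1)=1,$$ $$(KDw_f,Dv)_{L^2(0,1)}=\langle f,v\rangle\quad\forall v\in H^1_0(0,1),\qquad w_f(0)=w_f(1)=0.$$ Then $I^\beta_\theta u\in H^1(0,1)$ for every $u\in H^{1-\beta}_0(0,1)$, and a function $u$ is a weak solution of the Petrov–Galerkin problem, that is, $u\in H^{1-\beta}_0(0,1)$ and $$\bigl(KDI^\beta_\theta u,Dv\bigr)_{L^2(0,1)}=\langle f,v\rangle\qquad\forall v\in H^1_0(0,1),$$ if and only if $u\in H^{1-\beta}_0(0,1)$ and $u$ satisfies the integral equation $$I^\beta_\theta u-(1-\theta)\bigl({}_0^rI^\beta_1u\bigr)w_l-\theta\bigl({}_0^lI^\beta_1u\bigr)w_r=w_f\qquad\text{on }[0,1].$$ -/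

import Mathlib

open MeasureTheory Set Filter Topology
open scoped ENNReal Distributions FourierTransform

noncomputable section

namespace FracDiff

/-- The open interval `(0,1)`. -/
def unitInterval01 : TopologicalSpace.Opens ℝ := ⟨Ioo 0 1, isOpen_Ioo⟩

/-- Lebesgue measure on `(0,1)`. -/
def mu01 : Measure ℝ := volume.restrict (Ioo 0 1)

/-- Left fractional integral of order `σ` with base point `a`. -/
def leftFracInt (a σ : ℝ) (w : ℝ → ℝ) (x : ℝ) : ℝ :=
  (1 / Real.Gamma σ) * ∫ s in a..x, w s / (x - s) ^ (1 - σ)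

/-- Right fractional integral of order `σ` with end point `b`. -/
def rightFracInt (b σ : ℝ) (w : ℝ → ℝ) (x : ℝ) : ℝ :=
  (1 / Real.Gamma σ) * ∫ s in x..b, w s / (s - x) ^ (1 - σ)

/-- The two-sided fractional integral on `(0,1)`: `θ` times the left integral plus
`1 - θ` times the right integral. -/
def twoSidedFracInt (β θ : ℝ) (w : ℝ → ℝ) (x : ℝ) : ℝ :=
  θ * leftFracInt 0 β w x + (1 - θ) * rightFracInt 1 β w x

/-- The norm of `H^μ(ℝ)` of a real function (meant for smooth compactly supported functions):
the square root of `‖φ‖²_{L²(ℝ)} + ‖|ω|^μ 𝓕φ‖²_{L²(ℝ)}`. The Fourier transform is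
normalised with `exp (-2πiωx)`; other normalisations give equivalent norms. -/
def sobolevNorm (μ : ℝ) (φ : ℝ → ℝ) : ℝ≥0∞ :=
  (eLpNorm φ 2 volume ^ 2 +
    eLpNorm (fun ω : ℝ => ((|ω| ^ μ : ℝ) : ℂ) * 𝓕 (fun x : ℝ => (φ x : ℂ)) ω) 2 volume ^ 2)
      ^ (1 / 2 : ℝ)

/-- `u ∈ H^μ_0(0,1)`, the completion of `C_c^∞(0,1)` in the norm of `H^μ(ℝ)`, realised as a
space of functions in `L²(0,1)`: `u` is the `L²(0,1)`-limit of test functions that form a Cauchy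
sequence in the norm of `H^μ(ℝ)`. Only the values of `u` almost everywhere in `(0,1)` matter. -/
def MemHZero (μ : ℝ) (u : ℝ → ℝ) : Prop :=
  MemLp u 2 mu01 ∧
  ∃ φ : ℕ → 𝓓(unitInterval01, ℝ),
    (∀ ε : ℝ≥0∞, 0 < ε → ∃ N : ℕ, ∀ m ≥ N, ∀ n ≥ N,
      sobolevNorm μ (fun x => φ m x - φ n x) < ε) ∧
    Tendsto (fun n => eLpNorm (fun x => φ n x - u x) 2 mu01) atTop (𝓝 0)

/-- `w ∈ H¹(0,1)` with weak derivative `g`: both are in `L²(0,1)` and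
`∫ w φ' = - ∫ g φ` for every test function `φ ∈ C_c^∞(0,1)`. -/
structure HasL2WeakDeriv (w g : ℝ → ℝ) : Prop where
  memLp : MemLp w 2 mu01
  memLp_deriv : MemLp g 2 mu01
  integral_eq : ∀ φ : 𝓓(unitInterval01, ℝ),
    ∫ x, w x * deriv φ x ∂mu01 = - ∫ x, g x * φ x ∂mu01

/-- The Sobolev space `H¹(0,1)`. -/
def MemH1 (w : ℝ → ℝ) : Prop := ∃ g : ℝ → ℝ, HasL2WeakDeriv w g

/-- `L²(0,1) × L²(0,1)` with the Hilbert norm `(‖p‖² + ‖q‖²)^{1/2}`. -/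
abbrev L2Pair : Type := WithLp 2 (Lp ℝ 2 mu01 × Lp ℝ 2 mu01)

/-- The pairs `(φ, φ')`, `φ ∈ C_c^∞(0,1)`. -/
def testGraph : Submodule ℝ L2Pair where
  carrier := {p | ∃ φ : 𝓓(unitInterval01, ℝ), p.fst =ᵐ[mu01] φ ∧ p.snd =ᵐ[mu01] deriv φ}
  zero_mem' := by
    refine ⟨0, ?_, ?_⟩
    · exact Lp.coeFn_zero ℝ 2 mu01
    · refine (Lp.coeFn_zero ℝ 2 mu01).trans (Eventually.of_forall fun x => ?_)
      have : ((0 : 𝓓(unitInterval01, ℝ)) : ℝ → ℝ) = fun _ => 0 := rfl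
      simp [this]
  add_mem' := by
    rintro p q ⟨φ, hφ, hφ'⟩ ⟨ψ, hψ, hψ'⟩
    refine ⟨φ + ψ, ?_, ?_⟩
    · filter_upwards [Lp.coeFn_add p.fst q.fst, hφ, hψ] with x h1 h2 h3
      change (p.fst + q.fst : Lp ℝ 2 mu01) x = φ x + ψ x
      rw [h1, Pi.add_apply, h2, h3]
    · filter_upwards [Lp.coeFn_add p.snd q.snd, hφ', hψ'] with x h1 h2 h3
      change (p.snd + q.snd : Lp ℝ 2 mu01) x = deriv ((φ : ℝ → ℝ) + (ψ : ℝ → ℝ)) x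
      rw [h1, Pi.add_apply, h2, h3, deriv_add]
      · exact (φ.contDiff.differentiable (by simp)) x
      · exact (ψ.contDiff.differentiable (by simp)) x
  smul_mem' := by
    rintro c p ⟨φ, hφ, hφ'⟩
    refine ⟨c • φ, ?_, ?_⟩
    · filter_upwards [Lp.coeFn_smul c p.fst, hφ] with x h1 h2
      change (c • p.fst : Lp ℝ 2 mu01) x = c • φ x
      rw [h1, Pi.smul_apply, h2]
    · filter_upwards [Lp.coeFn_smul c p.snd, hφ'] with x h1 h2
      change (c • p.snd : Lp ℝ 2 mu01) x = deriv (c • (φ : ℝ → ℝ)) x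
      rw [h1, Pi.smul_apply, h2, deriv_const_smul]
      exact (φ.contDiff.differentiable (by simp)) x

/-- The Hilbert space `H¹_0(0,1)`: the completion of `C_c^∞(0,1)` in the norm
`(‖v‖² + ‖Dv‖²)^{1/2}`. An element `v` is stored as the pair `(v, Dv)`. -/
def H10 : Submodule ℝ L2Pair := testGraph.topologicalClosure

/-- The weak derivative `Dv ∈ L²(0,1)` of `v ∈ H¹_0(0,1)`. -/
def H10.D (v : H10) : Lp ℝ 2 mu01 := v.1.snd

/-- The dual space `H⁻¹(0,1)` of `H¹_0(0,1)`. -/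
abbrev HMinus1 : Type := H10 →L[ℝ] ℝ

/-- `w ∈ H¹(0,1)`, given by its continuous representative on `[0,1]`, is the weak solution of
`-D(K Dw) = f` in `(0,1)`, `w(0) = a`, `w(1) = b`:
`(K Dw, Dv)_{L²(0,1)} = ⟨f, v⟩` for all `v ∈ H¹_0(0,1)`. -/
def IsDiffusionSolution (K : ℝ → ℝ) (f : HMinus1) (a b : ℝ) (w : ℝ → ℝ) : Prop :=
  ContinuousOn w (Icc 0 1) ∧ w 0 = a ∧ w 1 = b ∧
  ∃ g : ℝ → ℝ, HasL2WeakDeriv w g ∧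
    ∀ v : H10, ∫ x, K x * g x * H10.D v x ∂mu01 = f v

/-- `u` is a weak solution of the Petrov-Galerkin formulation: `u ∈ H^{1-β}_0(0,1)` and
`(K D I^β_θ u, Dv)_{L²(0,1)} = ⟨f, v⟩` for all `v ∈ H¹_0(0,1)`, where `D I^β_θ u` is the
weak derivative in `L²(0,1)`. -/
def IsPetrovGalerkinSolution (β θ : ℝ) (K : ℝ → ℝ) (f : HMinus1) (u : ℝ → ℝ) : Prop :=
  MemHZero (1 - β) u ∧
  ∃ g : ℝ → ℝ, HasL2WeakDeriv (twoSidedFracInt β θ u) g ∧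
    ∀ v : H10, ∫ x, K x * g x * H10.D v x ∂mu01 = f v

end FracDiff

end

/-!
By linearity and energy uniqueness of the diffusion problem, a weak solution with load `f` and
boundary values `a`, `b` is `w_f + a w_l + b w_r`; a Petrov-Galerkin solution `u` is exactly an
element of `H^{1-β}_0(0,1)` for which `I^β_θ u` is the weak solution whose boundary values are
those of `I^β_θ u`. What has to be shown is therefore that `I^β_θ` maps `H^{1-β}_0(0,1)` into
`H¹(0,1) ∩ C[0,1]`. On functions vanishing off `(0,1)` it is a combination of convolutions with the
truncated kernel `t^{β-1}` and its reflection, whose Fourier transforms are `O(|ω|^{-β})` because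
the kernel is monotone; by Plancherel this gains `β` derivatives. Since `1 - β > 1/2`, the Sobolev
embedding makes `u` a uniform limit of test functions, which gives continuity.
-/

open scoped SchwartzMap BoundedContinuousFunction

namespace FracDiff

/-! ### Weak derivatives and the diffusion problem on `(0,1)` -/

instance : IsProbabilityMeasure mu01 := ⟨by simp [mu01]⟩

theorem integral_mu01_eq_intervalIntegral (h : ℝ → ℝ) :
    ∫ x, h x ∂mu01 = ∫ x in (0 : ℝ)..1, h x := by
  rw [mu01, intervalIntegral.integral_of_le zero_le_one, integral_Ioc_eq_integral_Ioo]

theorem memLp_mu01_of_continuousOn {w : ℝ → ℝ} (hw : ContinuousOn w (Icc 0 1)) (p : ℝ≥0∞) :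
    MemLp w p mu01 := by
  obtain ⟨C, hC⟩ := isCompact_Icc.exists_bound_of_continuousOn hw
  refine MemLp.of_bound ((hw.mono Ioo_subset_Icc_self).aestronglyMeasurable measurableSet_Ioo) C ?_
  exact (ae_restrict_mem measurableSet_Ioo).mono fun x hx => hC x (Ioo_subset_Icc_self hx)

theorem intervalIntegrable_of_integrable_mu01 {h : ℝ → ℝ} (hh : Integrable h mu01) :
    IntervalIntegrable h volume 0 1 :=
  (intervalIntegrable_iff_integrableOn_Ioo_of_le zero_le_one).2 hh

section TestFunctions

variable (φ : 𝓓(unitInterval01, ℝ))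

theorem testFunction_eq_zero_of_notMem {x : ℝ} (hx : x ∉ Ioo (0 : ℝ) 1) : φ x = 0 :=
  image_eq_zero_of_notMem_tsupport fun h => hx (φ.tsupport_subset h)

theorem differentiable_testFunction : Differentiable ℝ φ :=
  φ.contDiff.differentiable (by simp)

theorem memLp_testFunction (p : ℝ≥0∞) : MemLp φ p mu01 :=
  memLp_mu01_of_continuousOn φ.continuous.continuousOn p

theorem memLp_deriv_testFunction (p : ℝ≥0∞) : MemLp (deriv φ) p mu01 :=
  memLp_mu01_of_continuousOn (φ.contDiff.continuous_deriv (by simp)).continuousOn p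

theorem exists_tsupport_subset_Icc : ∃ a b : ℝ, 0 < a ∧ b < 1 ∧ tsupport φ ⊆ Icc a b := by
  have hc : IsCompact (insert (1 / 2) (tsupport φ)) := φ.hasCompactSupport.isCompact.insert _
  have hsub : insert (1 / 2) (tsupport φ) ⊆ Ioo (0 : ℝ) 1 :=
    insert_subset (by norm_num) φ.tsupport_subset
  obtain ⟨a, ha, ha_le⟩ := hc.exists_isLeast (insert_nonempty _ _)
  obtain ⟨b, hb, hb_ge⟩ := hc.exists_isGreatest (insert_nonempty _ _)
  exact ⟨a, b, (hsub ha).1, (hsub hb).2, fun x hx =>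
    ⟨ha_le (mem_insert_of_mem _ hx), hb_ge (mem_insert_of_mem _ hx)⟩⟩

theorem exists_testFunction_deriv_eq (h0 : ∫ x, φ x ∂mu01 = 0) :
    ∃ ψ : 𝓓(unitInterval01, ℝ), deriv ψ = φ := by
  obtain ⟨a, b, ha, hb, hφ⟩ := exists_tsupport_subset_Icc φ
  have hφ_zero : ∀ x ∉ Icc a b, φ x = 0 := fun x hx =>
    image_eq_zero_of_notMem_tsupport fun h => hx (hφ h)
  have hφ_int : ∀ x y, IntervalIntegrable φ volume x y := φ.continuous.intervalIntegrable
  rw [integral_mu01_eq_intervalIntegral] at h0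
  let Φ : ℝ → ℝ := fun x => ∫ s in (0 : ℝ)..x, φ s
  have hΦ : ∀ x, HasDerivAt Φ (φ x) x := fun x =>
    (φ.continuous.integral_hasStrictDerivAt 0 x).hasDerivAt
  have hΦ_deriv : deriv Φ = φ := funext fun x => (hΦ x).deriv
  have hΦ_left : ∀ x < a, Φ x = 0 := fun x hx => by
    refine (intervalIntegral.integral_congr fun s hs => hφ_zero s fun hs' => ?_).trans
      intervalIntegral.integral_zero
    exact (hs.2.trans_lt (max_lt ha hx)).not_ge hs'.1
  have hΦ_right : ∀ x > b, Φ x = 0 := fun x hx => by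
    rw [← h0, ← sub_eq_zero, intervalIntegral.integral_interval_sub_left (hφ_int _ _) (hφ_int _ _)]
    refine (intervalIntegral.integral_congr fun s hs => hφ_zero s fun hs' => ?_).trans
      intervalIntegral.integral_zero
    exact (lt_min hb hx |>.trans_le hs.1).not_ge hs'.2
  have hΦ_supp : tsupport Φ ⊆ Icc a b := by
    refine closure_minimal (fun x hx => ⟨?_, ?_⟩) isClosed_Icc <;> by_contra! h
    exacts [hx (hΦ_left x h), hx (hΦ_right x h)]
  refine ⟨⟨Φ, ?_, ?_, hΦ_supp.trans (Icc_subset_Ioo ha hb)⟩, hΦ_deriv⟩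
  · rw [contDiff_infty_iff_deriv, hΦ_deriv]
    exact ⟨fun x => (hΦ x).differentiableAt, φ.contDiff⟩
  · exact HasCompactSupport.of_support_subset_isCompact isCompact_Icc
      ((subset_tsupport _).trans hΦ_supp)

theorem exists_testFunction_integral_eq_one : ∃ η : 𝓓(unitInterval01, ℝ), ∫ x, η x ∂mu01 = 1 := by
  let B : ContDiffBump (1 / 2 : ℝ) := ⟨1 / 8, 1 / 4, by norm_num, by norm_num⟩
  have hB : tsupport (B.normed volume) ⊆ Ioo 0 1 := by
    rw [B.tsupport_normed_eq, Real.closedBall_eq_Icc]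
    exact Icc_subset_Ioo (by norm_num [B]) (by norm_num [B])
  refine ⟨⟨B.normed volume, B.contDiff_normed, B.hasCompactSupport_normed, hB⟩, ?_⟩
  refine Eq.trans ?_ (B.integral_normed (μ := volume))
  exact setIntegral_eq_integral_of_forall_compl_eq_zero fun x hx =>
    image_eq_zero_of_notMem_tsupport fun h => hx (hB h)

end TestFunctions

theorem ae_eq_const_of_integral_mul_deriv_eq_zero {w : ℝ → ℝ} (hw : Integrable w mu01)
    (h : ∀ φ : 𝓓(unitInterval01, ℝ), ∫ x, w x * deriv φ x ∂mu01 = 0) :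
    ∃ c : ℝ, w =ᵐ[mu01] fun _ => c := by
  obtain ⟨η, hη⟩ := exists_testFunction_integral_eq_one
  have hint : ∀ φ : 𝓓(unitInterval01, ℝ), Integrable (fun x => w x * φ x) mu01 := fun φ =>
    hw.mul_of_top_left (memLp_testFunction φ ⊤)
  have hφ_int : ∀ φ : 𝓓(unitInterval01, ℝ), Integrable φ mu01 := fun φ =>
    (memLp_testFunction φ 1).integrable le_rfl
  let c := ∫ x, w x * η x ∂mu01
  have orthogonal : ∀ φ : 𝓓(unitInterval01, ℝ), ∫ x, φ x * (w x - c) ∂mu01 = 0 := by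
    intro φ
    let m := ∫ x, φ x ∂mu01
    obtain ⟨ψ, hψ⟩ : ∃ ψ : 𝓓(unitInterval01, ℝ), deriv ψ = fun x => φ x - m * η x :=
      exists_testFunction_deriv_eq (φ - m • η) <| by
        change ∫ x, (φ x - m * η x) ∂mu01 = 0
        rw [integral_sub (hφ_int φ) ((hφ_int η).const_mul m), integral_const_mul, hη, mul_one,
          sub_self]
    calc ∫ x, φ x * (w x - c) ∂mu01
        = ∫ x, w x * φ x ∂mu01 - c * m := by
          simp_rw [mul_sub]
          rw [integral_sub _ ((hφ_int φ).mul_const c), integral_mul_const, mul_comm c]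
          · simp only [mul_comm (φ _), m]
          · simpa only [mul_comm] using hint φ
      _ = ∫ x, w x * deriv ψ x ∂mu01 := by
          simp_rw [hψ, mul_sub, mul_left_comm _ m]
          rw [integral_sub (hint φ) ((hint η).const_mul m), integral_const_mul, mul_comm c]
      _ = 0 := h ψ
  have hae := isOpen_Ioo.ae_eq_zero_of_integral_contDiff_smul_eq_zero (μ := mu01)
    (f := fun x => w x - c) (U := Ioo 0 1)
    ((hw.sub (integrable_const c)).locallyIntegrable.locallyIntegrableOn _)
    (fun g hg hgc hgs => orthogonal ⟨g, hg, hgc, hgs⟩)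
  refine ⟨c, ?_⟩
  filter_upwards [hae, ae_restrict_mem measurableSet_Ioo] with x hx hx'
  exact sub_eq_zero.1 (hx hx')

theorem integral_primitive_mul_deriv {h : ℝ → ℝ} (hh : Integrable h mu01)
    (φ : 𝓓(unitInterval01, ℝ)) :
    ∫ x, (∫ s in (0 : ℝ)..x, h s) * deriv φ x ∂mu01 = - ∫ x, h x * φ x ∂mu01 := by
  have hh01 := intervalIntegrable_of_integrable_mu01 hh
  have hH := hh01.absolutelyContinuousOnInterval_intervalIntegral (c := 0) (by simp)
  have hφ : AbsolutelyContinuousOnInterval φ 0 1 :=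
    (φ.contDiff.of_le (by simp)).contDiffOn.absolutelyContinuousOnInterval
  rw [integral_mu01_eq_intervalIntegral, hH.integral_mul_deriv_eq_deriv_mul hφ,
    testFunction_eq_zero_of_notMem φ (x := 1) (by simp),
    testFunction_eq_zero_of_notMem φ (x := 0) (by simp), integral_mu01_eq_intervalIntegral]
  simp only [mul_zero, sub_self, zero_sub, neg_inj]
  refine intervalIntegral.integral_congr_ae ?_
  filter_upwards [hh01.ae_hasDerivAt_integral] with x hx hx'
  rw [(hx (uIoc_subset_uIcc hx') 0 (by simp)).deriv]

namespace HasL2WeakDeriv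

variable {w g w₁ w₂ g₁ g₂ : ℝ → ℝ}

theorem integrable_deriv (h : HasL2WeakDeriv w g) : Integrable g mu01 :=
  h.memLp_deriv.integrable (by norm_num)

theorem sub_eq_integral (h : HasL2WeakDeriv w g) (hw : ContinuousOn w (Icc 0 1)) {x : ℝ}
    (hx : x ∈ Icc (0 : ℝ) 1) : w x - w 0 = ∫ s in (0 : ℝ)..x, g s := by
  let G : ℝ → ℝ := fun x => ∫ s in (0 : ℝ)..x, g s
  have hG : ContinuousOn G (Icc 0 1) := by
    simpa only [uIcc_of_le zero_le_one] using
      ((intervalIntegrable_of_integrable_mu01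
        h.integrable_deriv).absolutelyContinuousOnInterval_intervalIntegral
          (c := 0) (by simp)).continuousOn
  have hint : ∀ {v : ℝ → ℝ}, ContinuousOn v (Icc 0 1) → Integrable v mu01 := fun hv =>
    (memLp_mu01_of_continuousOn hv 1).integrable le_rfl
  obtain ⟨c, hc⟩ : ∃ c : ℝ, w - G =ᵐ[mu01] fun _ => c :=
    ae_eq_const_of_integral_mul_deriv_eq_zero ((hint hw).sub (hint hG)) fun φ => by
      simp_rw [Pi.sub_apply, sub_mul]
      rw [integral_sub, h.integral_eq, integral_primitive_mul_deriv h.integrable_deriv, sub_self]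
      · exact (hint hw).mul_of_top_left (memLp_deriv_testFunction φ ⊤)
      · exact (hint hG).mul_of_top_left (memLp_deriv_testFunction φ ⊤)
  have hwG : EqOn (w - G) (fun _ => c) (Icc 0 1) :=
    (Measure.eqOn_open_of_ae_eq hc isOpen_Ioo ((hw.sub hG).mono Ioo_subset_Icc_self)
      continuousOn_const).of_subset_closure (hw.sub hG) continuousOn_const Ioo_subset_Icc_self
      (by rw [closure_Ioo zero_ne_one])
  have hx_eq : w x - G x = c := hwG hx
  have h0_eq : w 0 - G 0 = c := hwG (left_mem_Icc.2 zero_le_one)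
  have hG0 : G 0 = 0 := intervalIntegral.integral_same
  linarith

theorem add (h₁ : HasL2WeakDeriv w₁ g₁) (h₂ : HasL2WeakDeriv w₂ g₂) :
    HasL2WeakDeriv (fun x => w₁ x + w₂ x) (fun x => g₁ x + g₂ x) where
  memLp := h₁.memLp.add h₂.memLp
  memLp_deriv := h₁.memLp_deriv.add h₂.memLp_deriv
  integral_eq φ := by
    have hφ := memLp_testFunction φ 2
    have hφ' := memLp_deriv_testFunction φ 2
    simp_rw [add_mul]
    rw [integral_add, integral_add, h₁.integral_eq, h₂.integral_eq, neg_add]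
    exacts [h₁.memLp_deriv.integrable_mul hφ, h₂.memLp_deriv.integrable_mul hφ,
      h₁.memLp.integrable_mul hφ', h₂.memLp.integrable_mul hφ']

theorem const_mul (h : HasL2WeakDeriv w g) (c : ℝ) :
    HasL2WeakDeriv (fun x => c * w x) (fun x => c * g x) where
  memLp := h.memLp.const_mul c
  memLp_deriv := h.memLp_deriv.const_mul c
  integral_eq φ := by
    simp_rw [mul_assoc]
    rw [integral_const_mul, integral_const_mul, h.integral_eq, mul_neg]

theorem congr (h : HasL2WeakDeriv w₁ g) (heq : EqOn w₁ w₂ (Ioo 0 1)) : HasL2WeakDeriv w₂ g := by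
  have hae : w₁ =ᵐ[mu01] w₂ := (ae_restrict_mem measurableSet_Ioo).mono heq
  refine ⟨(memLp_congr_ae hae).1 h.memLp, h.memLp_deriv, fun φ => ?_⟩
  rw [← h.integral_eq]
  exact integral_congr_ae (hae.mono fun x hx => by simp only [hx])

end HasL2WeakDeriv

theorem exists_H10_D_ae_eq_deriv (φ : 𝓓(unitInterval01, ℝ)) :
    ∃ v : H10, H10.D v =ᵐ[mu01] deriv φ :=
  have hφ := memLp_testFunction φ 2
  have hφ' := memLp_deriv_testFunction φ 2
  ⟨⟨WithLp.toLp 2 (hφ.toLp φ, hφ'.toLp (deriv φ)),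
    testGraph.le_topologicalClosure ⟨φ, hφ.coeFn_toLp, hφ'.coeFn_toLp⟩⟩, hφ'.coeFn_toLp⟩

theorem integrable_mul_mul_D {K g : ℝ → ℝ} (hK : MemLp K ⊤ mu01) (hg : MemLp g 2 mu01) (v : H10) :
    Integrable (fun x => K x * g x * H10.D v x) mu01 :=
  have hKg : MemLp (fun x => K x * g x) 2 mu01 := hg.mul' hK
  hKg.integrable_mul (Lp.memLp (H10.D v))

namespace IsDiffusionSolution

variable {K : ℝ → ℝ} {f f₁ f₂ : HMinus1} {a b a₁ b₁ a₂ b₂ : ℝ} {w w₁ w₂ : ℝ → ℝ}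

theorem add (hK : MemLp K ⊤ mu01) (h₁ : IsDiffusionSolution K f₁ a₁ b₁ w₁)
    (h₂ : IsDiffusionSolution K f₂ a₂ b₂ w₂) :
    IsDiffusionSolution K (f₁ + f₂) (a₁ + a₂) (b₁ + b₂) (fun x => w₁ x + w₂ x) := by
  obtain ⟨hw₁, rfl, rfl, g₁, hg₁, hf₁⟩ := h₁
  obtain ⟨hw₂, rfl, rfl, g₂, hg₂, hf₂⟩ := h₂
  refine ⟨hw₁.add hw₂, rfl, rfl, _, hg₁.add hg₂, fun v => ?_⟩
  simp_rw [mul_add, add_mul]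
  rw [integral_add (integrable_mul_mul_D hK hg₁.memLp_deriv v)
    (integrable_mul_mul_D hK hg₂.memLp_deriv v), hf₁, hf₂, add_apply]

theorem const_mul (h : IsDiffusionSolution K f a b w) (c : ℝ) :
    IsDiffusionSolution K (c • f) (c * a) (c * b) (fun x => c * w x) := by
  obtain ⟨hw, rfl, rfl, g, hg, hf⟩ := h
  refine ⟨continuousOn_const.mul hw, rfl, rfl, _, hg.const_mul c, fun v => ?_⟩
  simp_rw [mul_left_comm _ c, mul_assoc c]
  rw [integral_const_mul, hf, smul_apply, smul_eq_mul]

theorem congr (h : IsDiffusionSolution K f a b w₁) (heq : EqOn w₂ w₁ (Icc 0 1)) :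
    IsDiffusionSolution K f a b w₂ := by
  obtain ⟨hw, rfl, rfl, g, hg, hf⟩ := h
  exact ⟨hw.congr heq, heq (by simp), heq (by simp), g,
    hg.congr (heq.symm.mono Ioo_subset_Icc_self), hf⟩

theorem eqOn_zero (hK : MemLp K ⊤ mu01) (hK_pos : ∀ᵐ x ∂mu01, 0 < K x)
    (hw : IsDiffusionSolution K 0 0 0 w) : EqOn w 0 (Icc 0 1) := by
  obtain ⟨hw_cont, hw0, hw1, g, hg, hweak⟩ := hw
  have hKg : MemLp (fun x => K x * g x) 2 mu01 := hg.memLp_deriv.mul' hK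
  obtain ⟨c, hflux⟩ : ∃ c : ℝ, (fun x => K x * g x) =ᵐ[mu01] fun _ => c := by
    refine ae_eq_const_of_integral_mul_deriv_eq_zero (hKg.integrable (by norm_num)) fun φ => ?_
    obtain ⟨v, hv⟩ := exists_H10_D_ae_eq_deriv φ
    exact (integral_congr_ae (hv.symm.mono fun x hx => by simp only [hx])).trans (hweak v)
  have henergy : ∫ x, K x * g x * g x ∂mu01 = 0 := calc
    _ = c * ∫ x, g x ∂mu01 := by
      rw [← integral_const_mul]
      exact integral_congr_ae (hflux.mono fun x hx => by simp only [hx])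
    _ = 0 := by
      rw [integral_mu01_eq_intervalIntegral, ← hg.sub_eq_integral hw_cont (by simp), hw0, hw1,
        sub_self, mul_zero]
  have henergy_nonneg : 0 ≤ᵐ[mu01] fun x => K x * g x * g x := by
    filter_upwards [hK_pos] with x hx
    simpa only [mul_assoc, Pi.zero_apply] using mul_nonneg hx.le (mul_self_nonneg (g x))
  have hg_zero : g =ᵐ[mu01] 0 := by
    filter_upwards [hK_pos, (integral_eq_zero_iff_of_nonneg_ae henergy_nonneg
      (hKg.integrable_mul hg.memLp_deriv)).1 henergy] with x hx hx0
    simpa [mul_assoc, hx.ne'] using hx0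
  intro x hx
  have hftc := hg.sub_eq_integral hw_cont hx
  rw [hw0, sub_zero, intervalIntegral.integral_of_le hx.1, integral_Ioc_eq_integral_Ioo] at hftc
  rw [hftc, Pi.zero_apply]
  exact setIntegral_eq_zero_of_ae_eq_zero <| (ae_imp_of_ae_restrict hg_zero).mono
    fun s hs hsx => hs (Ioo_subset_Ioo_right hx.2 hsx)

theorem eqOn (hK : MemLp K ⊤ mu01) (hK_pos : ∀ᵐ x ∂mu01, 0 < K x)
    (h₁ : IsDiffusionSolution K f a b w₁) (h₂ : IsDiffusionSolution K f a b w₂) :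
    EqOn w₁ w₂ (Icc 0 1) := by
  have hdiff : IsDiffusionSolution K 0 0 0 (fun x => w₁ x + -1 * w₂ x) := by
    have hzero : f + (-1 : ℝ) • f = 0 := by ext; simp
    simpa [hzero] using h₁.add hK (h₂.const_mul (-1))
  intro x hx
  linarith [show w₁ x + -1 * w₂ x = 0 from hdiff.eqOn_zero hK hK_pos hx]

end IsDiffusionSolution

theorem exists_inner_eq_of_norm_le {E H : Type*} [AddCommGroup E] [Module ℝ E]
    [NormedAddCommGroup H] [InnerProductSpace ℝ H] [CompleteSpace H] (ℓ : E →ₗ[ℝ] ℝ)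
    (T : E →ₗ[ℝ] H) (h : ∃ C, ∀ x, ‖ℓ x‖ ≤ C * ‖T x‖) :
    ∃ G : H, ∀ x, inner ℝ G (T x) = ℓ x := by
  obtain ⟨L, hL, -⟩ := exists_extension_norm_eq (LinearMap.range T) (ℓ.compLeftInverse T)
  refine ⟨(InnerProductSpace.toDual ℝ H).symm L, fun x => ?_⟩
  rw [InnerProductSpace.toDual_symm_apply]
  exact (hL ⟨T x, x, rfl⟩).trans (LinearMap.compLeftInverse_apply_of_bdd ℓ T h x (T x) rfl)

/-- The embedding of the test functions on `(0,1)` into `L²(0,1)`. -/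
noncomputable def testFunctionToL2 : 𝓓(unitInterval01, ℝ) →ₗ[ℝ] Lp ℝ 2 mu01 where
  toFun φ := (memLp_testFunction φ 2).toLp φ
  map_add' _ _ := rfl
  map_smul' _ _ := rfl

/-- The functional `φ ↦ ∫ w φ'` on test functions, that is, minus the distributional derivative
of `w`. -/
noncomputable def pairingDeriv {w : ℝ → ℝ} (hw : MemLp w 2 mu01) :
    𝓓(unitInterval01, ℝ) →ₗ[ℝ] ℝ where
  toFun φ := ∫ x, w x * deriv φ x ∂mu01
  map_add' φ ψ := by
    have hderiv : deriv (φ + ψ : 𝓓(unitInterval01, ℝ)) = fun x => deriv φ x + deriv ψ x :=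
      funext fun x =>
        deriv_add (differentiable_testFunction φ x) (differentiable_testFunction ψ x)
    simp_rw [hderiv, mul_add]
    exact integral_add (hw.integrable_mul (memLp_deriv_testFunction φ 2))
      (hw.integrable_mul (memLp_deriv_testFunction ψ 2))
  map_smul' c φ := by
    have hderiv : deriv (c • φ : 𝓓(unitInterval01, ℝ)) = fun x => c * deriv φ x :=
      funext fun x => deriv_const_smul c (differentiable_testFunction φ x)
    simp_rw [hderiv, mul_left_comm _ c]
    exact integral_const_mul _ _

theorem memH1_of_abs_integral_mul_deriv_le {w : ℝ → ℝ} (hw : MemLp w 2 mu01) (C : ℝ)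
    (hC : ∀ φ : 𝓓(unitInterval01, ℝ),
      |∫ x, w x * deriv φ x ∂mu01| ≤ C * (eLpNorm φ 2 mu01).toReal) : MemH1 w := by
  obtain ⟨G, hG⟩ := exists_inner_eq_of_norm_le (pairingDeriv hw) testFunctionToL2
    ⟨C, fun φ => (hC φ).trans_eq <| by
      rw [show ‖testFunctionToL2 φ‖ = _ from Lp.norm_toLp _ (memLp_testFunction φ 2)]⟩
  refine ⟨fun x => -G x, hw, (Lp.memLp G).neg, fun φ => ?_⟩
  calc ∫ x, w x * deriv φ x ∂mu01
      = inner ℝ G (testFunctionToL2 φ) := (hG φ).symm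
    _ = ∫ x, G x * φ x ∂mu01 := by
      rw [L2.inner_def]
      refine integral_congr_ae ?_
      filter_upwards [(memLp_testFunction φ 2).coeFn_toLp] with x hx
      rw [show testFunctionToL2 φ x = φ x from hx, real_inner_eq_re_inner, mul_comm]
      rfl
    _ = - ∫ x, -G x * φ x ∂mu01 := by
      simp_rw [neg_mul]
      rw [integral_neg, neg_neg]

/-! ### Fourier multipliers and the Sobolev embedding -/

theorem eLpNorm_fourier (f : 𝓢(ℝ, ℂ)) :
    eLpNorm (𝓕 (f : ℝ → ℂ)) 2 volume = eLpNorm f 2 volume := by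
  have h := f.norm_fourier_toL2_eq
  rw [SchwartzMap.norm_toLp, SchwartzMap.norm_toLp] at h
  rw [← SchwartzMap.fourier_coe]
  exact (ENNReal.toReal_eq_toReal_iff' ((𝓕 f).eLpNorm_lt_top 2 volume).ne
    (f.eLpNorm_lt_top 2 volume).ne).1 h

theorem eLpNorm_fourierInv (f : 𝓢(ℝ, ℂ)) :
    eLpNorm (𝓕⁻ (f : ℝ → ℂ)) 2 volume = eLpNorm f 2 volume := by
  rw [← SchwartzMap.fourierInv_coe, ← eLpNorm_fourier, ← SchwartzMap.fourier_coe,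
    FourierTransform.fourier_fourierInv_eq]

theorem continuous_fourier (f : 𝓢(ℝ, ℂ)) : Continuous (𝓕 (f : ℝ → ℂ)) := by
  rw [← SchwartzMap.fourier_coe]
  exact (𝓕 f).continuous

theorem aestronglyMeasurable_abs_rpow_mul_fourier (μ : ℝ) (f : 𝓢(ℝ, ℂ)) :
    AEStronglyMeasurable (fun ω : ℝ => ((|ω| ^ μ : ℝ) : ℂ) * 𝓕 (f : ℝ → ℂ) ω) volume :=
  Measurable.aestronglyMeasurable (by fun_prop) |>.mul (continuous_fourier f).aestronglyMeasurable

/-- The seminorm `‖|ω|^μ 𝓕f‖_{L²}` of the homogeneous Sobolev space `Ḣ^μ(ℝ)`, the second part of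
`sobolevNorm`; here for complex-valued functions. -/
noncomputable def homogSobolevNorm (μ : ℝ) (f : ℝ → ℂ) : ℝ≥0∞ :=
  eLpNorm (fun ω : ℝ => ((|ω| ^ μ : ℝ) : ℂ) * 𝓕 f ω) 2 volume

theorem le_rpow_half_sq_add_sq (a b : ℝ≥0∞) : a ≤ (a ^ 2 + b ^ 2) ^ (1 / 2 : ℝ) := calc
  a = (a ^ 2) ^ (1 / 2 : ℝ) := by rw [← ENNReal.rpow_natCast, ← ENNReal.rpow_mul]; norm_num
  _ ≤ (a ^ 2 + b ^ 2) ^ (1 / 2 : ℝ) := by gcongr; exact le_self_add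

theorem eLpNorm_le_sobolevNorm (μ : ℝ) (φ : ℝ → ℝ) : eLpNorm φ 2 volume ≤ sobolevNorm μ φ :=
  le_rpow_half_sq_add_sq _ _

theorem homogSobolevNorm_le_sobolevNorm (μ : ℝ) (φ : ℝ → ℝ) :
    homogSobolevNorm μ (fun x => (φ x : ℂ)) ≤ sobolevNorm μ φ := by
  rw [sobolevNorm, add_comm]
  exact le_rpow_half_sq_add_sq _ _

theorem homogSobolevNorm_add_le (μ : ℝ) (f g : 𝓢(ℝ, ℂ)) :
    homogSobolevNorm μ (f + g : 𝓢(ℝ, ℂ)) ≤ homogSobolevNorm μ f + homogSobolevNorm μ g := by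
  have hadd : 𝓕 ((f + g : 𝓢(ℝ, ℂ)) : ℝ → ℂ) = 𝓕 (f : ℝ → ℂ) + 𝓕 (g : ℝ → ℂ) := by
    simp_rw [← SchwartzMap.fourier_coe, FourierTransform.fourier_add]
    rfl
  simp_rw [homogSobolevNorm, hadd, Pi.add_apply, mul_add]
  exact eLpNorm_add_le (aestronglyMeasurable_abs_rpow_mul_fourier μ f)
    (aestronglyMeasurable_abs_rpow_mul_fourier μ g) one_le_two

theorem abs_rpow_le_one_add_abs_pow_ceil {μ : ℝ} (hμ : 0 ≤ μ) (ω : ℝ) :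
    |ω| ^ μ ≤ 1 + |ω| ^ ⌈μ⌉₊ := by
  rcases le_total |ω| 1 with h | h
  · exact (Real.rpow_le_one (abs_nonneg ω) h hμ).trans (le_add_of_nonneg_right (by positivity))
  · have := Real.rpow_le_rpow_of_exponent_le h (Nat.le_ceil μ)
    rw [Real.rpow_natCast] at this
    linarith

theorem homogSobolevNorm_lt_top {μ : ℝ} (hμ : 0 ≤ μ) (f : 𝓢(ℝ, ℂ)) :
    homogSobolevNorm μ f < ⊤ := by
  let F : 𝓢(ℝ, ℂ) := 𝓕 f
  let G : 𝓢(ℝ, ℂ) := SchwartzMap.smulLeftCLM ℂ (fun ω : ℝ => ω ^ ⌈μ⌉₊) F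
  have hG : ∀ ω, G ω = ω ^ ⌈μ⌉₊ • F ω := congrFun <|
    SchwartzMap.smulLeftCLM_apply (by fun_prop) F
  have hdom : MemLp (fun ω => ‖F ω‖ + ‖G ω‖) 2 volume := (F.memLp 2).norm.add (G.memLp 2).norm
  refine (hdom.of_le
    (aestronglyMeasurable_abs_rpow_mul_fourier μ f) (Eventually.of_forall fun ω => ?_)).2
  calc ‖((|ω| ^ μ : ℝ) : ℂ) * 𝓕 (f : ℝ → ℂ) ω‖
      = |ω| ^ μ * ‖F ω‖ := by
        rw [norm_mul, Complex.norm_real, Real.norm_of_nonneg (by positivity),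
          ← SchwartzMap.fourier_coe]
    _ ≤ (1 + |ω| ^ ⌈μ⌉₊) * ‖F ω‖ := by
        gcongr
        exact abs_rpow_le_one_add_abs_pow_ceil hμ ω
    _ = ‖F ω‖ + ‖G ω‖ := by
        rw [hG, norm_smul, norm_pow, Real.norm_eq_abs, add_mul, one_mul]
    _ ≤ ‖‖F ω‖ + ‖G ω‖‖ := Real.le_norm_self _

theorem memLp_inv_one_add_abs_rpow {μ : ℝ} (hμ : 1 / 2 < μ) :
    MemLp (fun ω : ℝ => (1 + |ω| ^ μ)⁻¹) 2 volume := by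
  have hbracket : MemLp (fun ω : ℝ => (1 + |ω|) ^ (-μ)) 2 volume := by
    rw [memLp_two_iff_integrable_sq (Measurable.aestronglyMeasurable (by fun_prop))]
    refine (integrable_one_add_norm (E := ℝ) (r := 2 * μ) (by simp; linarith)).congr
      (Eventually.of_forall fun ω => ?_)
    beta_reduce
    rw [Real.norm_eq_abs, ← Real.rpow_mul_natCast (by positivity)]
    congr 1
    push_cast
    ring
  refine hbracket.of_le_mul (c := 2 ^ μ) (Measurable.aestronglyMeasurable (by fun_prop))
    (Eventually.of_forall fun ω => ?_)
  have hpow : (1 + |ω|) ^ μ ≤ 2 ^ μ * (1 + |ω| ^ μ) := calc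
    (1 + |ω|) ^ μ ≤ (2 * max 1 |ω|) ^ μ := by
      gcongr
      linarith [le_max_left 1 |ω|, le_max_right 1 |ω|]
    _ = 2 ^ μ * max 1 |ω| ^ μ := Real.mul_rpow (by positivity) (by positivity)
    _ ≤ 2 ^ μ * (1 + |ω| ^ μ) := by
      gcongr
      rcases max_cases 1 |ω| with ⟨h, -⟩ | ⟨h, -⟩ <;> rw [h]
      · rw [Real.one_rpow]
        exact le_add_of_nonneg_right (by positivity)
      · exact le_add_of_nonneg_left zero_le_one
  rw [Real.norm_of_nonneg (by positivity), Real.norm_of_nonneg (by positivity),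
    Real.rpow_neg (by positivity), ← div_eq_mul_inv, inv_eq_one_div,
    div_le_div_iff₀ (by positivity) (by positivity), one_mul]
  exact hpow

theorem enorm_le_eLpNorm_fourier (f : 𝓢(ℝ, ℂ)) (x : ℝ) :
    ‖f x‖ₑ ≤ eLpNorm (𝓕 (f : ℝ → ℂ)) 1 volume := by
  have hinv : f x = 𝓕⁻ (𝓕 (f : ℝ → ℂ)) x := by
    rw [← SchwartzMap.fourier_coe, ← SchwartzMap.fourierInv_coe,
      FourierTransform.fourierInv_fourier_eq]
  rw [hinv, Real.fourierInv_eq, eLpNorm_one_eq_lintegral_enorm]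
  refine (enorm_integral_le_lintegral_enorm _).trans_eq (lintegral_congr fun ω => ?_)
  rw [enorm_eq_iff_norm_eq, Circle.norm_smul]

theorem enorm_le_mul_eLpNorm_add_homogSobolevNorm (μ : ℝ) (f : 𝓢(ℝ, ℂ)) (x : ℝ) :
    ‖f x‖ₑ ≤ eLpNorm (fun ω : ℝ => (1 + |ω| ^ μ)⁻¹) 2 volume *
      (eLpNorm f 2 volume + homogSobolevNorm μ f) := by
  let F : ℝ → ℂ := 𝓕 (f : ℝ → ℂ)
  let W : ℝ → ℂ := fun ω => ((|ω| ^ μ : ℝ) : ℂ) * F ω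
  have hF : AEStronglyMeasurable F volume := (continuous_fourier f).aestronglyMeasurable
  have hW : AEStronglyMeasurable W volume := aestronglyMeasurable_abs_rpow_mul_fourier μ f
  have hsplit : F = (fun ω : ℝ => (1 + |ω| ^ μ)⁻¹) • (F + W) := by
    funext ω
    have hpos : (1 + |ω| ^ μ : ℝ) ≠ 0 := by positivity
    rw [Pi.smul_apply', eq_inv_smul_iff₀ hpos, add_smul, one_smul, Complex.real_smul]
    rfl
  calc ‖f x‖ₑ ≤ eLpNorm F 1 volume := enorm_le_eLpNorm_fourier f x
    _ = eLpNorm ((fun ω : ℝ => (1 + |ω| ^ μ)⁻¹) • (F + W)) 1 volume :=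
        congrArg (eLpNorm · 1 volume) hsplit
    _ ≤ eLpNorm (fun ω : ℝ => (1 + |ω| ^ μ)⁻¹) 2 volume * eLpNorm (F + W) 2 volume :=
        eLpNorm_smul_le_mul_eLpNorm (hF.add hW) (Measurable.aestronglyMeasurable (by fun_prop))
    _ ≤ eLpNorm (fun ω : ℝ => (1 + |ω| ^ μ)⁻¹) 2 volume *
          (eLpNorm F 2 volume + eLpNorm W 2 volume) := by
        gcongr
        exact eLpNorm_add_le hF hW one_le_two
    _ = _ := by rw [eLpNorm_fourier, homogSobolevNorm]

open scoped Convolution in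
theorem integral_convolution_mul_eq {k f : ℝ → ℂ} (hk : Integrable k) (hf : Integrable f)
    (g : 𝓢(ℝ, ℂ)) :
    ∫ x, (k ⋆[ContinuousLinearMap.mul ℂ ℂ] f) x * g x =
      ∫ ω, 𝓕 k ω * 𝓕 f ω * 𝓕⁻ (g : ℝ → ℂ) ω := by
  have hg : (g : ℝ → ℂ) = 𝓕 (𝓕⁻ (g : ℝ → ℂ)) := by
    rw [← SchwartzMap.fourierInv_coe, ← SchwartzMap.fourier_coe,
      FourierTransform.fourier_fourierInv_eq]
  have hg_int : Integrable (𝓕⁻ (g : ℝ → ℂ)) := by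
    rw [← SchwartzMap.fourierInv_coe]
    exact (𝓕⁻ g).integrable
  have hswap := VectorFourier.integral_fourierIntegral_smul_eq_flip (L := innerₗ ℝ)
    Real.continuous_fourierChar continuous_inner
    (hk.integrable_convolution (ContinuousLinearMap.mul ℂ ℂ) hf) hg_int
  rw [flip_innerₗ] at hswap
  conv_lhs => rw [hg]
  refine hswap.symm.trans (integral_congr_ae (Eventually.of_forall fun ω => ?_))
  exact congrArg (· * 𝓕⁻ (g : ℝ → ℂ) ω) (Real.fourier_mul_convolution_eq hk hf ω)

theorem norm_fourierInv_deriv (g : 𝓢(ℝ, ℂ)) (ω : ℝ) :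
    ‖𝓕⁻ (deriv g) ω‖ = 2 * Real.pi * |ω| * ‖𝓕⁻ (g : ℝ → ℂ) ω‖ := by
  have hint : Integrable (deriv g) := (SchwartzMap.derivCLM ℂ ℂ g).integrable
  simp_rw [Real.fourierInv_eq_fourier_neg, Real.fourier_deriv g.integrable g.differentiable hint]
  simp [abs_of_pos Real.pi_pos]

open scoped Convolution in
/-- A kernel whose Fourier transform is `O(|ω|^{-β})` is smoothing of order `β`, in weak form. -/
theorem enorm_integral_convolution_mul_deriv_le {β A : ℝ} {k : ℝ → ℂ} (hk : Integrable k)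
    (hkF : ∀ ω : ℝ, ω ≠ 0 → ‖𝓕 k ω‖ ≤ A * |ω| ^ (-β)) (f g : 𝓢(ℝ, ℂ)) :
    ‖∫ x, (k ⋆[ContinuousLinearMap.mul ℂ ℂ] f) x * deriv g x‖ₑ ≤
      ENNReal.ofReal (2 * Real.pi * A) * (homogSobolevNorm (1 - β) f * eLpNorm g 2 volume) := by
  let W : ℝ → ℂ := fun ω => ((|ω| ^ (1 - β) : ℝ) : ℂ) * 𝓕 (f : ℝ → ℂ) ω
  have hbound : ∀ ω : ℝ, ω ≠ 0 → ‖𝓕 k ω * 𝓕 (f : ℝ → ℂ) ω * 𝓕⁻ (deriv g) ω‖ ≤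
      2 * Real.pi * A * ‖(W • 𝓕⁻ (g : ℝ → ℂ)) ω‖ := fun ω hω => by
    have hω' : 0 < |ω| := abs_pos.2 hω
    have hW : ‖W ω‖ = |ω| ^ (-β) * |ω| * ‖𝓕 (f : ℝ → ℂ) ω‖ := by
      rw [norm_mul, Complex.norm_real, Real.norm_of_nonneg (by positivity), sub_eq_neg_add,
        Real.rpow_add_one hω'.ne']
    calc _ ≤ A * |ω| ^ (-β) * ‖𝓕 (f : ℝ → ℂ) ω‖ *
          (2 * Real.pi * |ω| * ‖𝓕⁻ (g : ℝ → ℂ) ω‖) := by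
          rw [norm_mul, norm_mul, norm_fourierInv_deriv]
          gcongr
          exact hkF ω hω
      _ = _ := by
          rw [Pi.smul_apply', norm_smul, hW]
          ring
  calc _ = ‖∫ ω, 𝓕 k ω * 𝓕 (f : ℝ → ℂ) ω * 𝓕⁻ (deriv g) ω‖ₑ :=
        congrArg _ (integral_convolution_mul_eq hk f.integrable (SchwartzMap.derivCLM ℂ ℂ g))
    _ ≤ eLpNorm (fun ω => 𝓕 k ω * 𝓕 (f : ℝ → ℂ) ω * 𝓕⁻ (deriv g) ω) 1 volume := by
        rw [eLpNorm_one_eq_lintegral_enorm]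
        exact enorm_integral_le_lintegral_enorm _
    _ ≤ ENNReal.ofReal (2 * Real.pi * A) * eLpNorm (W • 𝓕⁻ (g : ℝ → ℂ)) 1 volume :=
        eLpNorm_le_mul_eLpNorm_of_ae_le_mul ((Measure.ae_ne volume 0).mono hbound) 1
    _ ≤ ENNReal.ofReal (2 * Real.pi * A) *
          (eLpNorm W 2 volume * eLpNorm (𝓕⁻ (g : ℝ → ℂ)) 2 volume) := by
        gcongr
        refine eLpNorm_smul_le_mul_eLpNorm ?_ (aestronglyMeasurable_abs_rpow_mul_fourier _ f)
        rw [← SchwartzMap.fourierInv_coe]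
        exact (𝓕⁻ g).continuous.aestronglyMeasurable
    _ = _ := by rw [eLpNorm_fourierInv, homogSobolevNorm]

/-! ### The kernel of the fractional integrals -/

section MonotoneKernel

variable {k : ℝ → ℝ} (hk : Integrable k) (hk_nonneg : 0 ≤ k) (hk_zero : ∀ t ≤ 0, k t = 0)
  (hk_anti : AntitoneOn k (Ioi 0))
include hk hk_nonneg hk_zero hk_anti

theorem integral_abs_sub_comp_sub {h : ℝ} (hh : 0 ≤ h) :
    ∫ t, |k t - k (t - h)| = 2 * ∫ t in (0 : ℝ)..h, k t := by
  have hpt : ∀ t, |k t - k (t - h)| = k (t - h) - k t + 2 * (Ioc 0 h).indicator k t := fun t => by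
    rcases le_or_gt t 0 with ht | ht
    · rw [hk_zero t ht, hk_zero (t - h) (by linarith), indicator_of_notMem fun h => ht.not_gt h.1]
      simp
    rcases le_or_gt t h with hth | hth
    · rw [hk_zero (t - h) (by linarith), indicator_of_mem (mem_Ioc.2 ⟨ht, hth⟩), sub_zero,
        abs_of_nonneg (hk_nonneg t)]
      ring
    · rw [indicator_of_notMem fun h => hth.not_ge h.2, abs_of_nonpos
        (sub_nonpos.2 (hk_anti (sub_pos.2 hth) ht (sub_le_self t hh)))]
      ring
  have hdiff : Integrable fun t => k (t - h) - k t := (hk.comp_sub_right h).sub hk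
  simp_rw [hpt]
  rw [integral_add hdiff ((hk.indicator measurableSet_Ioc).const_mul 2),
    integral_sub (hk.comp_sub_right h) hk, integral_sub_right_eq_self k h, sub_self, zero_add,
    integral_const_mul, integral_indicator measurableSet_Ioc, intervalIntegral.integral_of_le hh]

theorem integral_abs_sub_comp_add (s : ℝ) :
    ∫ t, |k t - k (t + s)| = 2 * ∫ t in (0 : ℝ)..|s|, k t := by
  have hsub {h : ℝ} := integral_abs_sub_comp_sub hk hk_nonneg hk_zero hk_anti (h := h)
  rcases le_total 0 s with hs | hs
  · rw [abs_of_nonneg hs, ← hsub hs, ← integral_sub_right_eq_self _ s]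
    simp_rw [sub_add_cancel, abs_sub_comm]
  · simpa only [abs_of_nonpos hs, sub_neg_eq_add] using hsub (neg_nonneg.2 hs)

-- Averaging the Fourier integral with its translate by half a period, where the character
-- changes sign, bounds it by the modulus of continuity of `k`.
theorem norm_fourier_le_integral {ω : ℝ} (hω : ω ≠ 0) :
    ‖𝓕 (fun t => (k t : ℂ)) ω‖ ≤ ∫ t in (0 : ℝ)..(2 * |ω|)⁻¹, k t := by
  let s : ℝ := (1 / (2 * ‖ω‖ ^ 2)) • ω
  have hs : |s| = (2 * |ω|)⁻¹ := by
    have : |ω| ≠ 0 := abs_ne_zero.2 hω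
    simp only [s, smul_eq_mul, abs_mul, Real.norm_eq_abs, abs_div, abs_one, abs_two, abs_pow,
      abs_abs]
    field_simp
  have hhalf : 𝓕 (fun t => (k t : ℂ)) ω = (1 / (2 : ℂ)) •
      ∫ t, Real.fourierChar (-inner ℝ t ω) • ((k t : ℂ) - k (t + s)) :=
    (Real.fourier_eq _ _).trans
      (fourierIntegral_eq_half_sub_half_period_translate hω hk.ofReal)
  calc ‖𝓕 (fun t => (k t : ℂ)) ω‖ ≤ 1 / 2 * ∫ t, |k t - k (t + s)| := by
        rw [hhalf, norm_smul]
        gcongr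
        · norm_num
        · refine (norm_integral_le_integral_norm _).trans_eq (integral_congr_ae (.of_forall ?_))
          intro t
          simp only [Circle.norm_smul, ← Complex.ofReal_sub, Complex.norm_real, Real.norm_eq_abs]
    _ = ∫ t in (0 : ℝ)..(2 * |ω|)⁻¹, k t := by
        rw [integral_abs_sub_comp_add hk hk_nonneg hk_zero hk_anti, hs]
        ring

end MonotoneKernel

theorem fourier_comp_neg (f : ℝ → ℂ) (ω : ℝ) : 𝓕 (fun t => f (-t)) ω = 𝓕 f (-ω) := by
  rw [Real.fourier_eq, Real.fourier_eq, ← integral_neg_eq_self]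
  simp

/-- The convolution kernel `t ^ (β - 1)` of the left fractional integral without the factor
`1 / Γ(β)`, cut off at `t = 1`, which does not affect the values on `(0,1)` of the fractional
integral of a function vanishing off `(0,1)`. -/
noncomputable def fracKernel (β : ℝ) : ℝ → ℝ := (Ioc 0 1).indicator fun t => t ^ (β - 1)

theorem integrable_fracKernel {β : ℝ} (hβ : 0 < β) : Integrable (fracKernel β) := by
  rw [fracKernel, integrable_indicator_iff measurableSet_Ioc,
    ← intervalIntegrable_iff_integrableOn_Ioc_of_le zero_le_one]
  exact intervalIntegral.intervalIntegrable_rpow' (by linarith)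

theorem fracKernel_nonneg (β : ℝ) : 0 ≤ fracKernel β :=
  indicator_nonneg fun _ ht => Real.rpow_nonneg ht.1.le _

theorem fracKernel_of_nonpos (β : ℝ) {t : ℝ} (ht : t ≤ 0) : fracKernel β t = 0 :=
  indicator_of_notMem (fun h => ht.not_gt h.1) _

theorem fracKernel_le_rpow (β : ℝ) {t : ℝ} (ht : 0 ≤ t) : fracKernel β t ≤ t ^ (β - 1) :=
  indicator_le_self' (fun _ _ => Real.rpow_nonneg ht _) t

theorem antitoneOn_fracKernel {β : ℝ} (hβ : β ≤ 1) : AntitoneOn (fracKernel β) (Ioi 0) := by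
  intro s hs t ht hst
  by_cases h : t ≤ 1
  · rw [fracKernel, indicator_of_mem (mem_Ioc.2 ⟨hs, hst.trans h⟩),
      indicator_of_mem (mem_Ioc.2 ⟨ht, h⟩)]
    exact Real.rpow_le_rpow_of_nonpos hs hst (by linarith)
  · rw [fracKernel, indicator_of_notMem fun ht => h ht.2]
    exact fracKernel_nonneg β s

theorem integral_fracKernel_le {β : ℝ} (hβ : 0 < β) {h : ℝ} (hh : 0 ≤ h) :
    ∫ t in (0 : ℝ)..h, fracKernel β t ≤ h ^ β / β := calc
  ∫ t in (0 : ℝ)..h, fracKernel β t ≤ ∫ t in (0 : ℝ)..h, t ^ (β - 1) :=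
    intervalIntegral.integral_mono_on hh (integrable_fracKernel hβ).intervalIntegrable
      (intervalIntegral.intervalIntegrable_rpow' (by linarith))
      fun _ ht => fracKernel_le_rpow β ht.1
  _ = h ^ β / β := by
    rw [integral_rpow (Or.inl (by linarith)), sub_add_cancel, Real.zero_rpow hβ.ne', sub_zero]

theorem norm_fourier_fracKernel_le {β : ℝ} (hβ₀ : 0 < β) (hβ₁ : β ≤ 1) {ω : ℝ} (hω : ω ≠ 0) :
    ‖𝓕 (fun t => (fracKernel β t : ℂ)) ω‖ ≤ 2⁻¹ ^ β / β * |ω| ^ (-β) := calc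
  _ ≤ ∫ t in (0 : ℝ)..(2 * |ω|)⁻¹, fracKernel β t :=
    norm_fourier_le_integral (integrable_fracKernel hβ₀) (fracKernel_nonneg β)
      (fun _ => fracKernel_of_nonpos β) (antitoneOn_fracKernel hβ₁) hω
  _ ≤ (2 * |ω|)⁻¹ ^ β / β := integral_fracKernel_le hβ₀ (by positivity)
  _ = 2⁻¹ ^ β / β * |ω| ^ (-β) := by
    rw [mul_inv, Real.mul_rpow (by positivity) (by positivity), Real.inv_rpow (abs_nonneg ω),
      Real.rpow_neg (abs_nonneg ω)]
    ring

theorem norm_fourier_fracKernel_neg_le {β : ℝ} (hβ₀ : 0 < β) (hβ₁ : β ≤ 1) {ω : ℝ}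
    (hω : ω ≠ 0) :
    ‖𝓕 (fun t => (fracKernel β (-t) : ℂ)) ω‖ ≤ 2⁻¹ ^ β / β * |ω| ^ (-β) := by
  rw [fourier_comp_neg fun t => (fracKernel β t : ℂ), ← abs_neg ω]
  exact norm_fourier_fracKernel_le hβ₀ hβ₁ (neg_ne_zero.2 hω)

theorem leftFracInt_congr_ae {σ : ℝ} {u v : ℝ → ℝ} (h : u =ᵐ[mu01] v) {x : ℝ}
    (hx : x ∈ Icc (0 : ℝ) 1) : leftFracInt 0 σ u x = leftFracInt 0 σ v x := by
  have hae : u =ᵐ[volume.restrict (Ioo 0 x)] v :=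
    ae_restrict_of_ae_restrict_of_subset (Ioo_subset_Ioo_right hx.2) h
  simp_rw [leftFracInt, intervalIntegral.integral_of_le hx.1, integral_Ioc_eq_integral_Ioo]
  congr 1
  exact integral_congr_ae (hae.mono fun s hs => by simp only [hs])

theorem rightFracInt_eq_leftFracInt (σ : ℝ) (u : ℝ → ℝ) (x : ℝ) :
    rightFracInt 1 σ u x = leftFracInt 0 σ (fun s => u (1 - s)) (1 - x) := by
  have hsubst := intervalIntegral.integral_comp_sub_left (a := 0) (b := 1 - x)
    (fun s => u s / (s - x) ^ (1 - σ)) 1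
  rw [sub_sub_cancel, sub_zero] at hsubst
  rw [rightFracInt, leftFracInt, ← hsubst]
  simp_rw [sub_right_comm]

theorem ae_eq_comp_one_sub {u v : ℝ → ℝ} (h : u =ᵐ[mu01] v) :
    (fun s => u (1 - s)) =ᵐ[mu01] fun s => v (1 - s) := by
  have hpres : MeasurePreserving (fun s : ℝ => 1 - s) mu01 mu01 := by
    simpa [mu01] using (volume.measurePreserving_sub_left (1 : ℝ)).restrict_preimage
      (measurableSet_Ioo (a := (0 : ℝ)) (b := 1))
  exact hpres.quasiMeasurePreserving.ae_eq_comp h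

theorem rightFracInt_congr_ae {σ : ℝ} {u v : ℝ → ℝ} (h : u =ᵐ[mu01] v) {x : ℝ}
    (hx : x ∈ Icc (0 : ℝ) 1) : rightFracInt 1 σ u x = rightFracInt 1 σ v x := by
  simp_rw [rightFracInt_eq_leftFracInt]
  exact leftFracInt_congr_ae (ae_eq_comp_one_sub h) ⟨sub_nonneg.2 hx.2, sub_le_self 1 hx.1⟩

theorem leftFracInt_eq_integral_fracKernel (β : ℝ) {v : ℝ → ℝ}
    (hv : ∀ x ∉ Ioo (0 : ℝ) 1, v x = 0) {x : ℝ} (hx : x ∈ Icc (0 : ℝ) 1) :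
    leftFracInt 0 β v x = 1 / Real.Gamma β * ∫ t, fracKernel β t * v (x - t) := by
  have hsubst := intervalIntegral.integral_comp_sub_left (a := 0) (b := x)
    (fun s => v s / (x - s) ^ (1 - β)) x
  rw [sub_self, sub_zero] at hsubst
  rw [leftFracInt, ← hsubst, intervalIntegral.integral_of_le hx.1,
    ← integral_indicator measurableSet_Ioc]
  congr 2 with t
  by_cases ht : t ∈ Ioc 0 x
  · have ht₁ : t ∈ Ioc (0 : ℝ) 1 := ⟨ht.1, ht.2.trans hx.2⟩
    rw [fracKernel, indicator_of_mem ht, indicator_of_mem ht₁, sub_sub_cancel, ← neg_sub 1 β,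
      Real.rpow_neg ht.1.le, div_eq_inv_mul]
  · rw [indicator_of_notMem ht]
    by_cases ht₁ : t ∈ Ioc (0 : ℝ) 1
    · rw [hv (x - t) fun h => ht ⟨ht₁.1, sub_nonneg.1 h.1.le⟩, mul_zero]
    · rw [fracKernel, indicator_of_notMem ht₁, zero_mul]

theorem rightFracInt_eq_integral_fracKernel (β : ℝ) {v : ℝ → ℝ}
    (hv : ∀ x ∉ Ioo (0 : ℝ) 1, v x = 0) {x : ℝ} (hx : x ∈ Icc (0 : ℝ) 1) :
    rightFracInt 1 β v x = 1 / Real.Gamma β * ∫ t, fracKernel β (-t) * v (x - t) := by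
  rw [rightFracInt_eq_leftFracInt, leftFracInt_eq_integral_fracKernel β
    (fun s hs => hv _ fun h => hs ⟨by linarith [h.2], by linarith [h.1]⟩)
    ⟨sub_nonneg.2 hx.2, sub_le_self 1 hx.1⟩, ← integral_neg_eq_self]
  simp_rw [sub_neg_eq_add, sub_add_eq_sub_sub, sub_sub_cancel]

/-! ### Convolutions of functions in `H^{1-β}_0(0,1)` -/

section ConvolutionOfBounded

variable {k : ℝ → ℝ} (hk : Integrable k)
include hk

theorem integrable_mul_comp_sub (f : ℝ →ᵇ ℝ) (x : ℝ) : Integrable fun t => k t * f (x - t) :=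
  hk.mul_bdd (f.continuous.comp (by fun_prop)).aestronglyMeasurable
    (Eventually.of_forall fun t => f.norm_coe_le_norm (x - t))

theorem norm_convolution_sub_convolution_le (f g : ℝ →ᵇ ℝ) (x : ℝ) :
    ‖(∫ t, k t * f (x - t)) - ∫ t, k t * g (x - t)‖ ≤ (∫ t, ‖k t‖) * dist f g := by
  rw [← integral_sub (integrable_mul_comp_sub hk f x) (integrable_mul_comp_sub hk g x),
    ← integral_mul_const]
  refine norm_integral_le_of_norm_le (hk.norm.mul_const _) (Eventually.of_forall fun t => ?_)
  rw [← mul_sub, norm_mul, ← dist_eq_norm (f (x - t))]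
  gcongr
  exact BoundedContinuousFunction.dist_coe_le_dist _

theorem continuous_convolution (f : ℝ →ᵇ ℝ) : Continuous fun x => ∫ t, k t * f (x - t) :=
  BddAbove.continuous_convolution_right_of_integrable (ContinuousLinearMap.mul ℝ ℝ)
    ⟨‖f‖, forall_mem_range.2 f.norm_coe_le_norm⟩ hk f.continuous

theorem integrable_convolution_mul_deriv (f : ℝ →ᵇ ℝ) (ψ : 𝓓(unitInterval01, ℝ)) :
    Integrable (fun x => (∫ t, k t * f (x - t)) * deriv ψ x) mu01 :=
  (memLp_mu01_of_continuousOn (continuous_convolution hk f).continuousOn 2).integrable_mul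
    (memLp_deriv_testFunction ψ 2)

theorem tendsto_integral_convolution_mul_deriv {f : ℕ → ℝ →ᵇ ℝ} {v : ℝ →ᵇ ℝ}
    (hf : Tendsto f atTop (𝓝 v)) (ψ : 𝓓(unitInterval01, ℝ)) :
    Tendsto (fun n => ∫ x, (∫ t, k t * f n (x - t)) * deriv ψ x ∂mu01) atTop
      (𝓝 (∫ x, (∫ t, k t * v (x - t)) * deriv ψ x ∂mu01)) := by
  rw [tendsto_iff_norm_sub_tendsto_zero]
  refine squeeze_zero (fun n => norm_nonneg _) (fun n => ?_)
    (g := fun n => (∫ t, ‖k t‖) * dist (f n) v * ∫ x, ‖deriv ψ x‖ ∂mu01)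
    (by simpa using ((tendsto_iff_dist_tendsto_zero.1 hf).const_mul
      (∫ t, ‖k t‖)).mul_const (∫ x, ‖deriv ψ x‖ ∂mu01))
  rw [← integral_sub (integrable_convolution_mul_deriv hk _ ψ)
    (integrable_convolution_mul_deriv hk _ ψ), ← integral_const_mul]
  refine norm_integral_le_of_norm_le
    (((memLp_deriv_testFunction ψ 1).integrable le_rfl).norm.const_mul _)
    (Eventually.of_forall fun x => ?_)
  rw [← sub_mul, norm_mul]
  gcongr
  exact norm_convolution_sub_convolution_le hk _ _ x

end ConvolutionOfBounded

section TestFunctionsOnTheLine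

variable (φ ψ : 𝓓(unitInterval01, ℝ))

/-- A test function on `(0,1)` as a complex-valued Schwartz function on `ℝ`, so that the Fourier
transform of Schwartz functions applies to it. -/
noncomputable def testFunctionToSchwartz : 𝓢(ℝ, ℂ) :=
  (φ.hasCompactSupport.comp_left Complex.ofReal_zero).toSchwartzMap
    (Complex.ofRealCLM.contDiff.comp φ.contDiff)

theorem testFunctionToSchwartz_apply (x : ℝ) : testFunctionToSchwartz φ x = (φ x : ℂ) := rfl

theorem deriv_testFunctionToSchwartz (x : ℝ) :
    deriv (testFunctionToSchwartz φ) x = ((deriv φ x : ℝ) : ℂ) :=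
  (differentiable_testFunction φ x).hasDerivAt.ofReal_comp.deriv

theorem eLpNorm_testFunctionToSchwartz (p : ℝ≥0∞) :
    eLpNorm (testFunctionToSchwartz φ) p volume = eLpNorm φ p volume :=
  eLpNorm_congr_norm_ae (Eventually.of_forall fun x => Complex.norm_real (φ x))

theorem eLpNorm_testFunction_mu01 (p : ℝ≥0∞) : eLpNorm φ p mu01 = eLpNorm φ p volume :=
  eLpNorm_restrict_eq_of_support_subset fun _ hx => by
    by_contra h
    exact hx (testFunction_eq_zero_of_notMem φ h)

theorem enorm_testFunction_le_mul_sobolevNorm (μ x : ℝ) :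
    ‖φ x‖ₑ ≤ eLpNorm (fun ω : ℝ => (1 + |ω| ^ μ)⁻¹) 2 volume * (2 * sobolevNorm μ φ) := calc
  ‖φ x‖ₑ = ‖testFunctionToSchwartz φ x‖ₑ := by
    rw [testFunctionToSchwartz_apply, enorm_eq_iff_norm_eq, Complex.norm_real]
  _ ≤ eLpNorm (fun ω : ℝ => (1 + |ω| ^ μ)⁻¹) 2 volume *
      (eLpNorm φ 2 volume + homogSobolevNorm μ fun x => (φ x : ℂ)) := by
    rw [← eLpNorm_testFunctionToSchwartz]
    exact enorm_le_mul_eLpNorm_add_homogSobolevNorm μ (testFunctionToSchwartz φ) x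
  _ ≤ _ := by
    rw [two_mul]
    gcongr
    · exact eLpNorm_le_sobolevNorm μ φ
    · exact homogSobolevNorm_le_sobolevNorm μ φ

theorem enorm_integral_convolution_testFunction_mul_deriv_le {β A : ℝ} {k : ℝ → ℝ}
    (hk : Integrable k)
    (hkF : ∀ ω : ℝ, ω ≠ 0 → ‖𝓕 (fun t => (k t : ℂ)) ω‖ ≤ A * |ω| ^ (-β)) :
    ‖∫ x, (∫ t, k t * φ (x - t)) * deriv ψ x ∂mu01‖ₑ ≤ ENNReal.ofReal (2 * Real.pi * A) *
      (homogSobolevNorm (1 - β) (testFunctionToSchwartz φ) * eLpNorm ψ 2 mu01) := by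
  have hline : ∫ x, (∫ t, k t * φ (x - t)) * deriv ψ x ∂mu01 =
      ∫ x, (∫ t, k t * φ (x - t)) * deriv ψ x :=
    setIntegral_eq_integral_of_forall_compl_eq_zero fun x hx => by
      rw [Function.notMem_support.1 fun h => hx (ψ.tsupport_subset (support_deriv_subset h)),
        mul_zero]
  rw [eLpNorm_testFunction_mu01, ← eLpNorm_testFunctionToSchwartz, hline]
  refine le_trans (le_of_eq ?_) (enorm_integral_convolution_mul_deriv_le hk.ofReal hkF
    (testFunctionToSchwartz φ) (testFunctionToSchwartz ψ))
  rw [enorm_eq_iff_norm_eq, ← Complex.norm_real, ← integral_complex_ofReal]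
  simp_rw [Complex.ofReal_mul, ← integral_complex_ofReal, Complex.ofReal_mul,
    deriv_testFunctionToSchwartz]
  rfl

end TestFunctionsOnTheLine

section CauchySequence

variable {μ : ℝ} {φ : ℕ → 𝓓(unitInterval01, ℝ)}
  (hφ : ∀ ε : ℝ≥0∞, 0 < ε → ∃ N : ℕ, ∀ m ≥ N, ∀ n ≥ N,
    sobolevNorm μ (fun x => φ m x - φ n x) < ε)
include hφ

theorem cauchySeq_of_cauchy_sobolevNorm (hμ : 1 / 2 < μ) :
    CauchySeq fun n => (φ n : ℝ →ᵇ ℝ) := by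
  let C : ℝ≥0∞ := eLpNorm (fun ω : ℝ => (1 + |ω| ^ μ)⁻¹) 2 volume
  have hC : C ≠ ⊤ := (memLp_inv_one_add_abs_rpow hμ).2.ne
  rw [Metric.cauchySeq_iff]
  intro ε hε
  obtain ⟨N, hN⟩ := hφ (ENNReal.ofReal (ε / 2) / (2 * C + 1))
    (ENNReal.div_pos (by simpa using hε) (by finiteness))
  refine ⟨N, fun m hm n hn => ((BoundedContinuousFunction.dist_le (half_pos hε).le).2
    fun x => ?_).trans_lt (half_lt_self hε)⟩
  have hsup : ‖φ m x - φ n x‖ₑ ≤ ENNReal.ofReal (ε / 2) := calc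
    ‖φ m x - φ n x‖ₑ ≤ C * (2 * sobolevNorm μ fun x => φ m x - φ n x) :=
      enorm_testFunction_le_mul_sobolevNorm (φ m - φ n) μ x
    _ = 2 * C * sobolevNorm μ fun x => φ m x - φ n x := by ring
    _ ≤ (2 * C + 1) * (ENNReal.ofReal (ε / 2) / (2 * C + 1)) := by
      gcongr
      · exact le_self_add
      · exact (hN m hm n hn).le
    _ ≤ ENNReal.ofReal (ε / 2) := ENNReal.mul_div_le
  rwa [← ofReal_norm, ENNReal.ofReal_le_ofReal_iff (half_pos hε).le] at hsup

theorem exists_eventually_homogSobolevNorm_le (hμ : 0 ≤ μ) :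
    ∃ S ≠ ⊤, ∀ᶠ n in atTop, homogSobolevNorm μ (testFunctionToSchwartz (φ n)) ≤ S := by
  obtain ⟨N, hN⟩ := hφ 1 one_pos
  refine ⟨1 + homogSobolevNorm μ (testFunctionToSchwartz (φ N)), ENNReal.add_ne_top.2
    ⟨ENNReal.one_ne_top, (homogSobolevNorm_lt_top hμ _).ne⟩, eventually_atTop.2 ⟨N, fun n hn => ?_⟩⟩
  have hsplit : testFunctionToSchwartz (φ n) =
      testFunctionToSchwartz (φ n - φ N) + testFunctionToSchwartz (φ N) := by
    ext x
    simp [testFunctionToSchwartz_apply]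
  have hdiff : homogSobolevNorm μ (testFunctionToSchwartz (φ n - φ N)) ≤ 1 :=
    (homogSobolevNorm_le_sobolevNorm μ (φ n - φ N : 𝓓(unitInterval01, ℝ))).trans
      (hN n hn N le_rfl).le
  rw [hsplit]
  exact (homogSobolevNorm_add_le μ _ _).trans (add_le_add_left hdiff _)

end CauchySequence

theorem eLpNorm_sub_le_dist (f g : ℝ →ᵇ ℝ) (p : ℝ≥0∞) :
    eLpNorm (fun x => f x - g x) p mu01 ≤ ENNReal.ofReal (dist f g) := by
  refine (eLpNorm_le_of_ae_bound (C := dist f g) (Eventually.of_forall fun x => ?_)).trans ?_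
  · rw [← dist_eq_norm]
    exact BoundedContinuousFunction.dist_coe_le_dist x
  · simp

theorem ae_eq_of_tendsto_of_tendsto_eLpNorm {f : ℕ → ℝ →ᵇ ℝ} {v : ℝ →ᵇ ℝ} {u : ℝ → ℝ}
    {p : ℝ≥0∞} (hp : 1 ≤ p) (hu : AEStronglyMeasurable u mu01) (hv : Tendsto f atTop (𝓝 v))
    (hlim : Tendsto (fun n => eLpNorm (fun x => f n x - u x) p mu01) atTop (𝓝 0)) :
    u =ᵐ[mu01] v := by
  have hmeas (g : ℝ →ᵇ ℝ) : AEStronglyMeasurable g mu01 := g.continuous.aestronglyMeasurable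
  have hdist : Tendsto (fun n => ENNReal.ofReal (dist (f n) v)) atTop (𝓝 0) := by
    simpa using ENNReal.tendsto_ofReal (tendsto_iff_dist_tendsto_zero.1 hv)
  have hzero : eLpNorm (u - ⇑v) p mu01 = 0 := by
    refine le_antisymm (ge_of_tendsto' (by simpa using hdist.add hlim) fun n => ?_) bot_le
    calc eLpNorm (u - ⇑v) p mu01
        = eLpNorm ((fun x => f n x - v x) - fun x => f n x - u x) p mu01 := by
          congr 1
          ext x
          simp
      _ ≤ eLpNorm (fun x => f n x - v x) p mu01 + eLpNorm (fun x => f n x - u x) p mu01 :=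
          eLpNorm_sub_le ((hmeas _).sub (hmeas _)) ((hmeas _).sub hu) hp
      _ ≤ _ := by
          gcongr
          exact eLpNorm_sub_le_dist (f n) v p
  exact ((eLpNorm_eq_zero_iff (hu.sub (hmeas v)) (one_pos.trans_le hp).ne').1 hzero).mono
    fun _ => sub_eq_zero.1

theorem eq_zero_of_tendsto_testFunction {φ : ℕ → 𝓓(unitInterval01, ℝ)} {v : ℝ →ᵇ ℝ}
    (hv : Tendsto (fun n => (φ n : ℝ →ᵇ ℝ)) atTop (𝓝 v)) {x : ℝ} (hx : x ∉ Ioo (0 : ℝ) 1) :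
    v x = 0 := by
  have hlim : Tendsto (fun n => φ n x) atTop (𝓝 (v x)) :=
    ((BoundedContinuousFunction.lipschitz_eval_const x).continuous.tendsto v).comp hv
  simp_rw [testFunction_eq_zero_of_notMem _ hx] at hlim
  exact tendsto_nhds_unique hlim tendsto_const_nhds

theorem memH1_convolution_of_tendsto {β A : ℝ} {k : ℝ → ℝ} (hk : Integrable k)
    (hkF : ∀ ω : ℝ, ω ≠ 0 → ‖𝓕 (fun t => (k t : ℂ)) ω‖ ≤ A * |ω| ^ (-β))
    {φ : ℕ → 𝓓(unitInterval01, ℝ)} {v : ℝ →ᵇ ℝ}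
    (hv : Tendsto (fun n => (φ n : ℝ →ᵇ ℝ)) atTop (𝓝 v)) {S : ℝ≥0∞} (hS : S ≠ ⊤)
    (hφ : ∀ᶠ n in atTop, homogSobolevNorm (1 - β) (testFunctionToSchwartz (φ n)) ≤ S) :
    MemH1 fun x => ∫ t, k t * v (x - t) := by
  let B : ℝ≥0∞ := ENNReal.ofReal (2 * Real.pi * A)
  refine memH1_of_abs_integral_mul_deriv_le
    (memLp_mu01_of_continuousOn (continuous_convolution hk v).continuousOn 2)
    (B * S).toReal fun ψ => ?_
  have hψ : eLpNorm ψ 2 mu01 ≠ ⊤ := (memLp_testFunction ψ 2).2.ne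
  have hbound : ‖∫ x, (∫ t, k t * v (x - t)) * deriv ψ x ∂mu01‖ₑ ≤
      B * S * eLpNorm ψ 2 mu01 := by
    refine le_of_tendsto ((continuous_enorm.tendsto _).comp
      (tendsto_integral_convolution_mul_deriv hk hv ψ)) (hφ.mono fun n hn => ?_)
    calc _ ≤ B * (homogSobolevNorm (1 - β) (testFunctionToSchwartz (φ n)) * eLpNorm ψ 2 mu01) :=
          enorm_integral_convolution_testFunction_mul_deriv_le (φ n) ψ hk hkF
      _ ≤ B * (S * eLpNorm ψ 2 mu01) := by gcongr
      _ = B * S * eLpNorm ψ 2 mu01 := (mul_assoc _ _ _).symm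
  simpa only [ENNReal.toReal_mul, toReal_enorm, Real.norm_eq_abs] using
    ENNReal.toReal_mono (by finiteness) hbound

theorem MemHZero.exists_ae_eq_forall_memH1_convolution {β : ℝ} (hβ : β < 1 / 2) {u : ℝ → ℝ}
    (hu : MemHZero (1 - β) u) :
    ∃ v : ℝ →ᵇ ℝ, (∀ x ∉ Ioo (0 : ℝ) 1, v x = 0) ∧ u =ᵐ[mu01] v ∧
      ∀ k : ℝ → ℝ, Integrable k →
        ∀ A : ℝ, (∀ ω : ℝ, ω ≠ 0 → ‖𝓕 (fun t => (k t : ℂ)) ω‖ ≤ A * |ω| ^ (-β)) →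
          MemH1 fun x => ∫ t, k t * v (x - t) := by
  obtain ⟨hu₂, φ, hφ, hlim⟩ := hu
  obtain ⟨v, hv⟩ := cauchySeq_tendsto_of_complete
    (cauchySeq_of_cauchy_sobolevNorm hφ (by linarith))
  obtain ⟨S, hS, hφS⟩ := exists_eventually_homogSobolevNorm_le hφ (by linarith)
  exact ⟨v, fun x => eq_zero_of_tendsto_testFunction hv,
    ae_eq_of_tendsto_of_tendsto_eLpNorm one_le_two hu₂.1 hv hlim,
    fun k hk A hkF => memH1_convolution_of_tendsto hk hkF hv hS hφS⟩

theorem MemHZero.continuousOn_and_memH1_twoSidedFracInt {β : ℝ} (hβ₀ : 0 < β) (hβ : β < 1 / 2)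
    {u : ℝ → ℝ} (hu : MemHZero (1 - β) u) (θ : ℝ) :
    ContinuousOn (twoSidedFracInt β θ u) (Icc 0 1) ∧ MemH1 (twoSidedFracInt β θ u) := by
  obtain ⟨v, hv, huv, hH1⟩ := hu.exists_ae_eq_forall_memH1_convolution hβ
  have hk := integrable_fracKernel hβ₀
  have hβ₁ : β ≤ 1 := by linarith
  obtain ⟨gl, hgl⟩ := hH1 _ hk _ fun ω => norm_fourier_fracKernel_le hβ₀ hβ₁
  obtain ⟨gr, hgr⟩ := hH1 _ hk.comp_neg _ fun ω => norm_fourier_fracKernel_neg_le hβ₀ hβ₁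
  have heq : EqOn (twoSidedFracInt β θ u)
      (fun x => θ * (1 / Real.Gamma β * ∫ t, fracKernel β t * v (x - t)) +
        (1 - θ) * (1 / Real.Gamma β * ∫ t, fracKernel β (-t) * v (x - t))) (Icc 0 1) := by
    intro x hx
    simp only [twoSidedFracInt, leftFracInt_congr_ae huv hx, rightFracInt_congr_ae huv hx,
      leftFracInt_eq_integral_fracKernel β hv hx, rightFracInt_eq_integral_fracKernel β hv hx]
  refine ⟨ContinuousOn.congr ?_ heq, _, (((hgl.const_mul _).const_mul _).add
    ((hgr.const_mul _).const_mul _)).congr (heq.symm.mono Ioo_subset_Icc_self)⟩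
  have hcl := continuous_convolution hk v
  have hcr := continuous_convolution hk.comp_neg v
  exact Continuous.continuousOn (by fun_prop)

/-! ### The Petrov-Galerkin problem -/

theorem twoSidedFracInt_zero (β θ : ℝ) (u : ℝ → ℝ) :
    twoSidedFracInt β θ u 0 = (1 - θ) * rightFracInt 1 β u 0 := by
  simp [twoSidedFracInt, leftFracInt]

theorem twoSidedFracInt_one (β θ : ℝ) (u : ℝ → ℝ) :
    twoSidedFracInt β θ u 1 = θ * leftFracInt 0 β u 1 := by
  simp [twoSidedFracInt, rightFracInt]

theorem isPetrovGalerkinSolution_iff {β : ℝ} (hβ₀ : 0 < β) (hβ : β < 1 / 2) (θ : ℝ)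
    (K : ℝ → ℝ) (f : HMinus1) (u : ℝ → ℝ) :
    IsPetrovGalerkinSolution β θ K f u ↔ MemHZero (1 - β) u ∧
      IsDiffusionSolution K f ((1 - θ) * rightFracInt 1 β u 0) (θ * leftFracInt 0 β u 1)
        (twoSidedFracInt β θ u) := by
  refine and_congr_right fun hu => ⟨fun h => ?_, fun h => h.2.2.2⟩
  exact ⟨(hu.continuousOn_and_memH1_twoSidedFracInt hβ₀ hβ θ).1, twoSidedFracInt_zero β θ u,
    twoSidedFracInt_one β θ u, h⟩

theorem theorem6p1_general {β : ℝ} (hβ₀ : 0 < β) (hβ : β < 1 / 2) (θ : ℝ) {K : ℝ → ℝ}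
    (hK : MemLp K ⊤ mu01) (hK_pos : ∀ᵐ x ∂mu01, 0 < K x) {f : HMinus1} {wl wr wf : ℝ → ℝ}
    (hwl : IsDiffusionSolution K 0 1 0 wl) (hwr : IsDiffusionSolution K 0 0 1 wr)
    (hwf : IsDiffusionSolution K f 0 0 wf) (u : ℝ → ℝ) :
    (MemHZero (1 - β) u → MemH1 (twoSidedFracInt β θ u)) ∧
    (IsPetrovGalerkinSolution β θ K f u ↔
      MemHZero (1 - β) u ∧
      ∀ x ∈ Icc (0 : ℝ) 1,
        twoSidedFracInt β θ u x - (1 - θ) * rightFracInt 1 β u 0 * wl x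
          - θ * leftFracInt 0 β u 1 * wr x = wf x) := by
  refine ⟨fun hu => (hu.continuousOn_and_memH1_twoSidedFracInt hβ₀ hβ θ).2, ?_⟩
  rw [isPetrovGalerkinSolution_iff hβ₀ hβ]
  refine and_congr_right fun _ => ?_
  set R := (1 - θ) * rightFracInt 1 β u 0
  set L := θ * leftFracInt 0 β u 1
  have hsup : IsDiffusionSolution K f R L fun x => wf x + R * wl x + L * wr x := by
    simpa using (hwf.add hK (hwl.const_mul R)).add hK (hwr.const_mul L)
  constructor
  · intro hI x hx
    linarith [hI.eqOn hK hK_pos hsup hx]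
  · intro heq
    exact hsup.congr fun x hx => by linarith [heq x hx]

end FracDiff

theorem theorem6p1 (β θ : ℝ) (hβ_pos : 0 < β) (hβ_lt : β < 1 / 2) (hθ_nonneg : 0 ≤ θ)
    (hθ_le : θ ≤ 1) (K : ℝ → ℝ) (Km KM : ℝ) (hKm : 0 < Km)
    (hK_meas : AEStronglyMeasurable K FracDiff.mu01)
    (hK_bounds : ∀ᵐ x ∂FracDiff.mu01, Km ≤ K x ∧ K x ≤ KM)
    (f : FracDiff.HMinus1) (wl wr wf : ℝ → ℝ)
    (hwl : FracDiff.IsDiffusionSolution K 0 1 0 wl)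
    (hwr : FracDiff.IsDiffusionSolution K 0 0 1 wr)
    (hwf : FracDiff.IsDiffusionSolution K f 0 0 wf)
    (u : ℝ → ℝ) :
    (FracDiff.MemHZero (1 - β) u → FracDiff.MemH1 (FracDiff.twoSidedFracInt β θ u)) ∧
    (FracDiff.IsPetrovGalerkinSolution β θ K f u ↔
      FracDiff.MemHZero (1 - β) u ∧
      ∀ x ∈ Set.Icc (0 : ℝ) 1,
        FracDiff.twoSidedFracInt β θ u x
          - (1 - θ) * FracDiff.rightFracInt 1 β u 0 * wl x
          - θ * FracDiff.leftFracInt 0 β u 1 * wr x = wf x) :=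
  FracDiff.theorem6p1_general hβ_pos hβ_lt θ
    (memLp_top_of_bound hK_meas KM <| hK_bounds.mono fun _ hx =>
      (Real.norm_of_nonneg (hKm.le.trans hx.1)).trans_le hx.2)
    (hK_bounds.mono fun _ hx => hKm.trans_le hx.1) hwl hwr hwf u
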